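/- For complex numbers $a,b,c$ with $c\ne 0,-1,-2,\dots$ let $${}_2F_1(a,b;c;z)=\sum_{n=0}^\infty\frac{(a)_n(b)_n}{(c)_n\,n!}z^n,\qquad |z|<1,$$ where $(x)_0=1$ and $(x)_n=x(x+1)\cdots(x+n-1)$ for $n\ge1$. An analytic function $f$ on the unit disk $\mathbb D=\{z\in\mathbb C:|z|<1\}$ with $f(0)=0$ and $f'(0)=1$ is called starlike of order $\alpha$ if $f(z)\neq 0$ for $z\in\mathbb D\setminus\{0\}$ and $\Re\big[zf'(z)/f(z)\big]>\alpha$ for all $z\in\mathbb D$ (the quotient being understood as $1$ at $z=0$). Theorem. Let $\alpha$ be a real constant with $0\le\alpha<1$ and let $a,b,c$ be complex numbers with $ab\ne0$ and $c\ne0,-1,-2,\dots$. Then the shifted hypergeometric function $z\,{}_2F_1(a,b;c;z)$ is starlike of order $\alpha$ if the following conditions are satisfied: (i) $p=a+b+1-c$ is a real number; (ii) $\Re[ab]>p(1-\alpha)$; (iii) $L\ge0$, $N\ge0$ and $LN-M^2\ge0$, where $$L=\frac{\Re[ab]}{1-\alpha}+p(1-2\alpha)-|a|^2-|b|^2+|c-1|^2-4\,\Im[a]\,\Im[b],$$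 $$M=\frac{\Im\big[ab(\bar a+\bar b-2+2\alpha)\big]}{1-\alpha},$$ $$N=\frac{\Re[ab]}{1-\alpha}+p(1-2\alpha)-|a|^2-|b|^2+|c-1|^2-\Big(2\Re[a]-\frac{|a|^2}{1-\alpha}\Big)\Big(2\Re[b]-\frac{|b|^2}{1-\alpha}\Big).$$ -/

import Mathlib

/-- `f` is starlike of order `α`: it is analytic on the open unit disk, normalized by
`f 0 = 0`, `f' 0 = 1`, and `Re (z f'(z) / f(z)) > α` on the disk.  The quotient has a removable
singularity with value `1` at the origin, so the inequality is stated at the points `z ≠ 0`,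
where `f` must not vanish in order that the quotient be defined. -/
def StarlikeOfOrder (α : ℝ) (f : ℂ → ℂ) : Prop :=
  AnalyticOnNhd ℂ f (Metric.ball 0 1) ∧ f 0 = 0 ∧ deriv f 0 = 1 ∧
    ∀ z ∈ Metric.ball (0 : ℂ) 1, z ≠ 0 → f z ≠ 0 ∧ α < (z * deriv f z / f z).re

/-- The shifted hypergeometric function `z ↦ z ₂F₁(a, b; c; z)`. -/
noncomputable def shiftedHypergeometric (a b c z : ℂ) : ℂ :=
  z * ordinaryHypergeometric a b c z

/-!
Let `θ = z d/dz`, `F = ₂F₁(a, b; c; ·)` and `w = θF / F`; for `z F` to be starlike of order `α`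
means that `Re w > -(1 - α)`. Let `z₀` be a point of least modulus where this fails. Then
`F z₀ ≠ 0`, since `Re w` tends to `-∞` along the radius to a zero of `F`, so
`Re w(z₀) = -(1 - α)`, and Jack's lemma for the half-plane gives `θw(z₀) = -s` with
`s ≥ |w(z₀)|² / (2 (1 - α))` real. The hypergeometric equation becomes the Riccati equation
`θw + w² + (c - 1) w = z (θw + w² + (a + b) w + a b)`, which at `z₀` reads `A = z₀ B`, with `A` the
left side. Here `|A|² - |B|²` is a quadratic form in `Im w` and `Re w`, nonnegative by (iii), plus a
multiple of `s - |w|² / (2 (1 - α))`, nonnegative by (ii). Hence `A = B = 0` and `p w + a b = 0`,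
which contradicts (ii) on the line `Re w = -(1 - α)`.
-/

open Filter Topology Metric
open scoped ComplexConjugate ComplexOrder

section Euler

variable {𝕜 : Type*} [NontriviallyNormedField 𝕜] {f g : 𝕜 → 𝕜} {z : 𝕜}

/-- The Euler operator `θ = z d/dz`. -/
noncomputable def eulerDeriv (f : 𝕜 → 𝕜) (z : 𝕜) : 𝕜 :=
  z * deriv f z

/-- The logarithmic Euler derivative `z f'(z) / f(z)`, whose real part measures starlikeness. It
takes the junk value `0` at the zeros of `f`. -/
noncomputable def eulerLogDeriv (f : 𝕜 → 𝕜) (z : 𝕜) : 𝕜 :=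
  eulerDeriv f z / f z

lemma eulerLogDeriv_eq_mul_logDeriv (f : 𝕜 → 𝕜) (z : 𝕜) :
    eulerLogDeriv f z = z * logDeriv f z :=
  mul_div_assoc ..

@[simp] lemma eulerLogDeriv_apply_zero (f : 𝕜 → 𝕜) : eulerLogDeriv f 0 = 0 := by
  simp [eulerLogDeriv, eulerDeriv]

lemma eulerLogDeriv_div (hfz : f z ≠ 0) (hgz : g z ≠ 0) (hf : DifferentiableAt 𝕜 f z)
    (hg : DifferentiableAt 𝕜 g z) :
    eulerLogDeriv (fun w => f w / g w) z = eulerLogDeriv f z - eulerLogDeriv g z := by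
  simp only [eulerLogDeriv_eq_mul_logDeriv, logDeriv_div z hfz hgz hf hg, mul_sub]

lemma eulerLogDeriv_id_mul (hz : z ≠ 0) (hfz : f z ≠ 0) (hf : DifferentiableAt 𝕜 f z) :
    eulerLogDeriv (fun w => w * f w) z = 1 + eulerLogDeriv f z := by
  simp only [eulerLogDeriv_eq_mul_logDeriv, logDeriv_mul z hz hfz differentiableAt_fun_id hf,
    logDeriv_id', mul_add, mul_one_div_cancel hz]

variable [CompleteSpace 𝕜]

lemma analyticAt_eulerLogDeriv (hf : AnalyticAt 𝕜 f z) (hz : f z ≠ 0) :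
    AnalyticAt 𝕜 (eulerLogDeriv f) z :=
  (analyticAt_id.mul hf.deriv).div hf hz

lemma eulerDeriv_eulerLogDeriv (hf : AnalyticAt 𝕜 f z) (hz : f z ≠ 0) :
    eulerDeriv (eulerLogDeriv f) z =
      eulerDeriv (eulerDeriv f) z / f z - eulerLogDeriv f z ^ 2 := by
  have hdiv : deriv (eulerLogDeriv f) z =
      (deriv (eulerDeriv f) z * f z - eulerDeriv f z * deriv f z) / f z ^ 2 :=
    deriv_div (analyticAt_id.mul hf.deriv).differentiableAt hf.differentiableAt hz
  rw [eulerDeriv, hdiv]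
  simp only [eulerLogDeriv, eulerDeriv]
  field_simp

end Euler

lemma re_conj_mul_deriv_nonpos_of_isLocalMaxOn {ψ : ℂ → ℂ} {s : Set ℂ} {z₀ y : ℂ}
    (hψ : DifferentiableAt ℂ ψ z₀) (hmax : IsLocalMaxOn (fun z => ‖ψ z‖) s z₀)
    (hseg : openSegment ℝ z₀ y ⊆ s) : (conj (ψ z₀) * ((y - z₀) * deriv ψ z₀)).re ≤ 0 := by
  have hmax_sq : IsLocalMaxOn (fun z => ‖ψ z‖ ^ 2) s z₀ := by
    filter_upwards [hmax] with z hz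
    gcongr
  have hle := hmax_sq.hasFDerivWithinAt_nonpos
    (hψ.hasDerivAt.hasFDerivAt.restrictScalars ℝ).norm_sq.hasFDerivWithinAt
    (sub_mem_posTangentConeAt_of_openSegment_subset hseg)
  have hle' : 2 * (conj (ψ z₀) * ((y - z₀) * deriv ψ z₀)).re ≤ 0 := by
    simpa [Complex.inner, mul_comm, mul_left_comm, -Complex.mul_re] using hle
  exact nonpos_of_mul_nonpos_right hle' two_pos

/-- Writing `X = z₀ ψ'(z₀) / ψ(z₀)`, the function `‖ψ‖²` has derivative a positive multiple of
`Re (X (ζ - 1))` at `z₀` in the inward direction `z₀ (ζ - 1)`, `‖ζ‖ ≤ 1`. Since `‖ψ‖` is maximal at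
`z₀`, taking `ζ = conj X / ‖X‖` yields `‖X‖ ≤ Re X`. -/
lemma eulerLogDeriv_nonneg_of_norm_le {ψ : ℂ → ℂ} {z₀ : ℂ} (hψ : DifferentiableAt ℂ ψ z₀)
    (hne : ψ z₀ ≠ 0) (hmax : ∀ z ∈ ball (0 : ℂ) ‖z₀‖, ‖ψ z‖ ≤ ‖ψ z₀‖) :
    0 ≤ eulerLogDeriv ψ z₀ := by
  have hvar : ∀ y ∈ closedBall (0 : ℂ) ‖z₀‖,
      (conj (ψ z₀) * ((y - z₀) * deriv ψ z₀)).re ≤ 0 := by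
    intro y hy
    rcases eq_or_ne z₀ y with rfl | hy_ne
    · simp
    · exact re_conj_mul_deriv_nonpos_of_isLocalMaxOn hψ (eventually_nhdsWithin_of_forall hmax)
        (openSegment_subset_ball_of_ne (by simp) hy hy_ne)
  set X := eulerLogDeriv ψ z₀ with hX
  have hy : z₀ * (conj X / ‖X‖) ∈ closedBall (0 : ℂ) ‖z₀‖ := by
    simpa using mul_le_of_le_one_right (norm_nonneg z₀) (div_self_le_one ‖X‖)
  have hdir : conj (ψ z₀) * ((z₀ * (conj X / ‖X‖) - z₀) * deriv ψ z₀) =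
      (‖ψ z₀‖ ^ 2 : ℝ) * (‖X‖ - X) := by
    have hX' : z₀ * deriv ψ z₀ = X * ψ z₀ := by rw [hX, eulerLogDeriv, eulerDeriv]; field_simp
    have hnorm : X * (conj X / ‖X‖) = ‖X‖ := by
      rw [← mul_div_assoc, Complex.mul_conj', pow_two, mul_self_div_self]
    push_cast
    linear_combination conj (ψ z₀) * (conj X / ‖X‖ - 1) * hX' +
      conj (ψ z₀) * ψ z₀ * hnorm + (‖X‖ - X) * Complex.conj_mul' (ψ z₀)
  have hle := hvar _ hy
  rw [hdir, Complex.re_ofReal_mul] at hle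
  have hsub := nonpos_of_mul_nonpos_right hle (by positivity)
  rw [Complex.sub_re, Complex.ofReal_re, sub_nonpos] at hsub
  exact Complex.re_eq_norm.1 (hsub.antisymm' (Complex.re_le_norm X))

/-- Jack's lemma; by the Schwarz lemma, `φ z / z` also has maximal modulus at `z₀`. -/
lemma one_le_eulerLogDeriv_of_norm_le {φ : ℂ → ℂ} {z₀ : ℂ}
    (hφ : DifferentiableOn ℂ φ (ball 0 ‖z₀‖)) (hφ₀ : DifferentiableAt ℂ φ z₀) (h0 : φ 0 = 0)
    (hne : φ z₀ ≠ 0) (hmax : ∀ z ∈ ball (0 : ℂ) ‖z₀‖, ‖φ z‖ ≤ ‖φ z₀‖) :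
    1 ≤ eulerLogDeriv φ z₀ := by
  have hz₀ : z₀ ≠ 0 := by
    rintro rfl
    exact hne h0
  have hschwarz : ∀ z ∈ ball (0 : ℂ) ‖z₀‖, ‖φ z / z‖ ≤ ‖φ z₀ / z₀‖ := by
    intro z hz
    have hle := Complex.dist_le_div_mul_dist_of_mapsTo_ball (R₂ := ‖φ z₀‖) hφ
      (fun w hw => by simpa [h0] using hmax w hw) hz
    simp only [h0, dist_zero_right] at hle
    simpa only [norm_div] using div_le_of_le_mul₀ (norm_nonneg z) (by positivity) hle
  have hquot : eulerLogDeriv (fun z => φ z / z) z₀ = eulerLogDeriv φ z₀ - 1 := by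
    rw [eulerLogDeriv_div (g := fun z => z) hne hz₀ hφ₀ differentiableAt_fun_id]
    simp [eulerLogDeriv, eulerDeriv, hz₀]
  rw [← sub_nonneg, ← hquot]
  exact eulerLogDeriv_nonneg_of_norm_le (hφ₀.div differentiableAt_fun_id hz₀)
    (div_ne_zero hne hz₀) hschwarz

lemma add_two_mul_ne_zero_of_neg_le_re {β : ℝ} (hβ : 0 < β) {z : ℂ} (hz : -β ≤ z.re) :
    z + 2 * β ≠ 0 := by
  intro h
  have hre : z.re + 2 * β = 0 := by simpa using congrArg Complex.re h
  linarith

lemma add_two_mul_eq_neg_conj_of_re_eq {β : ℝ} {z : ℂ} (hz : z.re = -β) :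
    z + 2 * β = -conj z := by
  have hconj := Complex.add_conj z
  rw [hz] at hconj
  push_cast at hconj
  linear_combination hconj

lemma norm_div_add_two_mul_le_one {β : ℝ} (hβ : 0 ≤ β) {z : ℂ} (hz : -β ≤ z.re) :
    ‖z / (z + 2 * β)‖ ≤ 1 := by
  rw [norm_div]
  refine div_le_one_of_le₀ ?_ (norm_nonneg _)
  have hsq : ‖z + 2 * β‖ ^ 2 - ‖z‖ ^ 2 = 4 * β * (z.re + β) := by
    have hnormSq := Complex.normSq_add z (2 * β)
    rw [Complex.normSq_eq_norm_sq, Complex.normSq_eq_norm_sq] at hnormSq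
    rw [hnormSq, Complex.normSq_apply]
    simp only [Complex.mul_re, Complex.re_ofNat, Complex.ofReal_re, Complex.im_ofNat,
      Complex.ofReal_im, mul_zero, sub_zero, Complex.mul_im, zero_mul, add_zero, map_mul,
      Complex.conj_ofReal, Complex.conj_re, Complex.conj_im, neg_zero]
    ring
  rw [← sq_le_sq₀ (norm_nonneg _) (norm_nonneg _), ← sub_nonneg, hsq]
  exact mul_nonneg (by positivity) (by linarith)

/-- Jack's lemma for `h / (h + 2β)`, since `w ↦ w / (w + 2β)` sends `Re w > -β` onto the unit
disk. -/
lemma exists_eulerDeriv_eq_neg_of_neg_le_re {h : ℂ → ℂ} {z₀ : ℂ} {β : ℝ} (hβ : 0 < β)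
    (hh : DifferentiableOn ℂ h (ball 0 ‖z₀‖)) (hh₀ : DifferentiableAt ℂ h z₀) (h0 : h 0 = 0)
    (hre : ∀ z ∈ ball (0 : ℂ) ‖z₀‖, -β ≤ (h z).re) (hre₀ : (h z₀).re = -β) :
    ∃ s : ℝ, ‖h z₀‖ ^ 2 / (2 * β) ≤ s ∧ eulerDeriv h z₀ = -s := by
  have hadd := add_two_mul_eq_neg_conj_of_re_eq hre₀
  have hne : h z₀ ≠ 0 := by
    intro h
    rw [h, Complex.zero_re] at hre₀
    linarith
  have hadd_ne := add_two_mul_ne_zero_of_neg_le_re hβ hre₀.ge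
  have hjack : 1 ≤ eulerLogDeriv (fun z => h z / (h z + 2 * β)) z₀ := by
    refine one_le_eulerLogDeriv_of_norm_le
      (hh.div (hh.add_const _) fun z hz => add_two_mul_ne_zero_of_neg_le_re hβ (hre z hz))
      (hh₀.div (hh₀.add_const _) hadd_ne) (by simp [h0]) (div_ne_zero hne hadd_ne) fun z hz => ?_
    have hunit : ‖h z₀ / (h z₀ + 2 * β)‖ = 1 := by
      rw [hadd, norm_div, norm_neg, Complex.norm_conj, div_self (norm_ne_zero_iff.2 hne)]
    exact hunit ▸ norm_div_add_two_mul_le_one hβ.le (hre z hz)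
  have hlog : eulerLogDeriv (fun z => h z / (h z + 2 * β)) z₀ =
      -(eulerDeriv h z₀ * (2 * β / ‖h z₀‖ ^ 2)) := by
    rw [eulerLogDeriv_div hne hadd_ne hh₀ (hh₀.add_const _)]
    simp only [eulerLogDeriv, eulerDeriv, deriv_add_const, hadd, ← Complex.mul_conj']
    have hconj_ne : conj (h z₀) ≠ 0 := by simpa using hne
    field_simp
    linear_combination z₀ * deriv h z₀ * hadd
  obtain ⟨m, hm, hmlog⟩ : ∃ m : ℝ, 1 ≤ m ∧ (m : ℂ) =
      eulerLogDeriv (fun z => h z / (h z + 2 * β)) z₀ :=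
    ⟨_, (Complex.le_def.1 hjack).1,
      (Complex.eq_re_of_ofReal_le (r := 1) (by simpa using hjack)).symm⟩
  refine ⟨m * (‖h z₀‖ ^ 2 / (2 * β)), le_mul_of_one_le_left (by positivity) hm, ?_⟩
  have hβ' : (β : ℂ) ≠ 0 := by exact_mod_cast hβ.ne'
  have hnorm : (‖h z₀‖ : ℂ) ≠ 0 := by simpa using hne
  push_cast
  rw [hmlog, hlog]
  field_simp

lemma tendsto_sub_mul_logDeriv {𝕜 : Type*} [NontriviallyNormedField 𝕜] [CompleteSpace 𝕜]
    {f : 𝕜 → 𝕜} {z₀ : 𝕜} (hf : AnalyticAt 𝕜 f z₀) (hord : analyticOrderAt f z₀ ≠ ⊤) :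
    Tendsto (fun z => (z - z₀) * logDeriv f z) (𝓝[≠] z₀) (𝓝 (analyticOrderNatAt f z₀)) := by
  set m := analyticOrderNatAt f z₀
  obtain ⟨g, hg, hg₀, hfg⟩ := hf.analyticOrderAt_ne_top.1 hord
  have hlim : Tendsto (fun z => m + (z - z₀) * logDeriv g z) (𝓝[≠] z₀) (𝓝 m) := by
    have hlog : ContinuousAt (logDeriv g) z₀ := (hg.deriv.div hg hg₀).continuousAt
    have hcont : ContinuousAt (fun z => m + (z - z₀) * logDeriv g z) z₀ := by fun_prop
    simpa using hcont.tendsto.mono_left nhdsWithin_le_nhds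
  refine hlim.congr' ?_
  filter_upwards [hfg.eventually_nhds.filter_mono nhdsWithin_le_nhds,
    (hg.continuousAt.eventually_ne hg₀).filter_mono nhdsWithin_le_nhds,
    hg.eventually_analyticAt.filter_mono nhdsWithin_le_nhds, self_mem_nhdsWithin]
    with z hfgz hgz hg hz
  have hsub : z - z₀ ≠ 0 := sub_ne_zero.2 hz
  have hpow : logDeriv f z = m / (z - z₀) + logDeriv g z := by
    rw [(logDeriv_congr_nhds hfgz).eq_of_nhds]
    simp only [smul_eq_mul]
    rw [logDeriv_mul (f := fun x => (x - z₀) ^ m) z (pow_ne_zero m hsub) hgz (by fun_prop)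
        hg.differentiableAt,
      logDeriv_fun_pow (by fun_prop)]
    simp [logDeriv_apply, div_eq_mul_inv, m]
  rw [hpow]
  field_simp

lemma tendsto_ofReal_mul_nhdsNE {z₀ : ℂ} (hz₀ : z₀ ≠ 0) :
    Tendsto (fun t : ℝ => (t : ℂ) * z₀) (𝓝[<] 1) (𝓝[≠] z₀) := by
  have hcont : Continuous fun t : ℝ => (t : ℂ) * z₀ := by fun_prop
  refine tendsto_nhdsWithin_iff.2
    ⟨(hcont.tendsto' 1 z₀ (by simp)).mono_left nhdsWithin_le_nhds, ?_⟩
  filter_upwards [self_mem_nhdsWithin] with t ht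
  simpa [hz₀] using (Set.mem_Iio.1 ht).ne

/-- Near a zero `z₀` of order `m`, `z f'(z) / f(z)` behaves like `m z₀ / (z - z₀)`. -/
lemma tendsto_sub_one_mul_re_eulerLogDeriv {f : ℂ → ℂ} {z₀ : ℂ} (hf : AnalyticAt ℂ f z₀)
    (hz₀ : z₀ ≠ 0) (hord : analyticOrderAt f z₀ ≠ ⊤) :
    Tendsto (fun t : ℝ => (t - 1) * (eulerLogDeriv f (t * z₀)).re) (𝓝[<] 1)
      (𝓝 (analyticOrderNatAt f z₀)) := by
  have hcast : Tendsto (fun t : ℝ => (t : ℂ)) (𝓝[<] 1) (𝓝 1) :=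
    (Complex.continuous_ofReal.tendsto' 1 1 Complex.ofReal_one).mono_left nhdsWithin_le_nhds
  have hlim := (Complex.continuous_re.tendsto _).comp
    (hcast.mul ((tendsto_sub_mul_logDeriv hf hord).comp (tendsto_ofReal_mul_nhdsNE hz₀)))
  rw [one_mul, Complex.natCast_re] at hlim
  refine hlim.congr fun t => ?_
  rw [← Complex.re_ofReal_mul, eulerLogDeriv_eq_mul_logDeriv, Function.comp_apply]
  congr 1
  simp only [Function.comp_apply]
  push_cast
  ring

lemma ne_zero_of_forall_ball_le_re_eulerLogDeriv {f : ℂ → ℂ} {z₀ : ℂ} {β : ℝ}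
    (hf : AnalyticAt ℂ f z₀) (hz₀ : z₀ ≠ 0)
    (hre : ∀ z ∈ ball (0 : ℂ) ‖z₀‖, f z ≠ 0 ∧ -β ≤ (eulerLogDeriv f z).re) : f z₀ ≠ 0 := by
  intro hfz₀
  have hball : ∀ᶠ t : ℝ in 𝓝[<] 1, t < 1 ∧ (t : ℂ) * z₀ ∈ ball (0 : ℂ) ‖z₀‖ := by
    filter_upwards [Ioo_mem_nhdsLT zero_lt_one] with t ht
    refine ⟨ht.2, ?_⟩
    rw [mem_ball_zero_iff, norm_mul, Complex.norm_of_nonneg ht.1.le]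
    exact mul_lt_of_lt_one_left (norm_pos_iff.2 hz₀) ht.2
  have hord : analyticOrderAt f z₀ ≠ ⊤ := fun htop => by
    have hzero := (tendsto_ofReal_mul_nhdsNE hz₀).eventually
      ((analyticOrderAt_eq_top.1 htop).filter_mono nhdsWithin_le_nhds)
    obtain ⟨t, hft, -, ht⟩ := (hzero.and hball).exists
    exact (hre _ ht).1 hft
  have hm : (0 : ℝ) < analyticOrderNatAt f z₀ := by
    have := hf.analyticOrderAt_ne_zero.2 hfz₀
    rw [← Nat.cast_analyticOrderNatAt hord] at this
    simpa [Nat.pos_iff_ne_zero] using this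
  have hcont : Continuous fun t : ℝ => (t - 1) * -β := by fun_prop
  have hbound : Tendsto (fun t : ℝ => (t - 1) * -β) (𝓝[<] 1) (𝓝 0) :=
    (hcont.tendsto' 1 0 (by simp)).mono_left nhdsWithin_le_nhds
  refine hm.not_ge
    (le_of_tendsto_of_tendsto (tendsto_sub_one_mul_re_eulerLogDeriv hf hz₀ hord) hbound ?_)
  filter_upwards [hball] with t ⟨ht₁, ht⟩
  exact mul_le_mul_of_nonpos_left (hre _ ht).2 (sub_nonpos.2 ht₁.le)

lemma exists_notMem_ball_norm_subset {E : Type*} [SeminormedAddCommGroup E] [ProperSpace E]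
    {G : Set E} {R : ℝ} (hG : IsOpen G) (hGR : ¬ball 0 R ⊆ G) :
    ∃ z₀ ∈ ball 0 R, z₀ ∉ G ∧ ball 0 ‖z₀‖ ⊆ G := by
  obtain ⟨z₁, hz₁, hz₁G⟩ := Set.not_subset.1 hGR
  obtain ⟨z₀, ⟨hz₀, hz₀G⟩, hmin⟩ :=
    ((isCompact_closedBall 0 ‖z₁‖).diff hG).exists_isMinOn ⟨z₁, by simp, hz₁G⟩
      continuous_norm.continuousOn
  rw [mem_closedBall_zero_iff] at hz₀
  rw [mem_ball_zero_iff] at hz₁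
  refine ⟨z₀, mem_ball_zero_iff.2 (hz₀.trans_lt hz₁), hz₀G, fun z hz => ?_⟩
  rw [mem_ball_zero_iff] at hz
  by_contra hzG
  exact hz.not_ge (hmin ⟨mem_closedBall_zero_iff.2 (hz.le.trans hz₀), hzG⟩)

lemma isOpen_setOf_lt_re_eulerLogDeriv {f : ℂ → ℂ} {U : Set ℂ} (hU : IsOpen U)
    (hf : AnalyticOnNhd ℂ f U) (β : ℝ) :
    IsOpen {z ∈ U | f z ≠ 0 ∧ -β < (eulerLogDeriv f z).re} := by
  rw [isOpen_iff_mem_nhds]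
  rintro z ⟨hzU, hfz, hre⟩
  have hcont := (analyticAt_eulerLogDeriv (hf z hzU) hfz).continuousAt
  filter_upwards [hU.mem_nhds hzU, (hf z hzU).continuousAt.eventually_ne hfz,
    (Complex.continuous_re.continuousAt.comp hcont).eventually (lt_mem_nhds hre)] with w h1 h2 h3
  exact ⟨h1, h2, h3⟩

lemma exists_re_eulerLogDeriv_eq_of_not_forall_lt {f : ℂ → ℂ} {β R : ℝ} (hβ : 0 < β)
    (hf : AnalyticOnNhd ℂ f (ball 0 R)) (hf0 : f 0 ≠ 0)
    (hnot : ¬∀ z ∈ ball (0 : ℂ) R, f z ≠ 0 ∧ -β < (eulerLogDeriv f z).re) :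
    ∃ z₀ ∈ ball (0 : ℂ) R, f z₀ ≠ 0 ∧ (eulerLogDeriv f z₀).re = -β ∧
      ∀ z ∈ ball (0 : ℂ) ‖z₀‖, f z ≠ 0 ∧ -β < (eulerLogDeriv f z).re := by
  obtain ⟨z₀, hz₀, hbad, hgood⟩ := exists_notMem_ball_norm_subset
    (isOpen_setOf_lt_re_eulerLogDeriv isOpen_ball hf β) fun hsub => hnot fun z hz => (hsub hz).2
  replace hgood z (hz : z ∈ ball 0 ‖z₀‖) := (hgood hz).2
  have hne : z₀ ≠ 0 := by
    rintro rfl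
    exact hbad ⟨hz₀, hf0, by simpa using hβ⟩
  have hfz₀ : f z₀ ≠ 0 := ne_zero_of_forall_ball_le_re_eulerLogDeriv (hf z₀ hz₀) hne
    fun z hz => ⟨(hgood z hz).1, (hgood z hz).2.le⟩
  refine ⟨z₀, hz₀, hfz₀, le_antisymm ?_ ?_, hgood⟩
  · by_contra! hlt
    exact hbad ⟨hz₀, hfz₀, hlt⟩
  · have hcl : z₀ ∈ closure (ball (0 : ℂ) ‖z₀‖) := by
      simp [closure_ball _ (norm_ne_zero_iff.2 hne)]
    have hcont := (analyticAt_eulerLogDeriv (hf z₀ hz₀) hfz₀).continuousAt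
    exact ge_of_tendsto_of_frequently
      ((Complex.continuous_re.continuousAt.comp hcont).tendsto)
      ((mem_closure_iff_frequently.1 hcl).mono fun z hz => (hgood z hz).2.le)

theorem lt_re_eulerLogDeriv_of_eulerDeriv_ne {f : ℂ → ℂ} {β R : ℝ} (hβ : 0 < β)
    (hf : AnalyticOnNhd ℂ f (ball 0 R)) (hf0 : f 0 ≠ 0)
    (hadm : ∀ z ∈ ball (0 : ℂ) R, f z ≠ 0 → (eulerLogDeriv f z).re = -β →
      ∀ s : ℝ, ‖eulerLogDeriv f z‖ ^ 2 / (2 * β) ≤ s → eulerDeriv (eulerLogDeriv f) z ≠ -s) :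
    ∀ z ∈ ball (0 : ℂ) R, f z ≠ 0 ∧ -β < (eulerLogDeriv f z).re := by
  by_contra hnot
  obtain ⟨z₀, hz₀, hfz₀, hre₀, hgood⟩ := exists_re_eulerLogDeriv_eq_of_not_forall_lt hβ hf hf0 hnot
  have hdiff : ∀ z ∈ ball (0 : ℂ) R, f z ≠ 0 → DifferentiableAt ℂ (eulerLogDeriv f) z :=
    fun z hz hfz => (analyticAt_eulerLogDeriv (hf z hz) hfz).differentiableAt
  have hsub : ball (0 : ℂ) ‖z₀‖ ⊆ ball 0 R := ball_subset_ball (mem_ball_zero_iff.1 hz₀).le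
  obtain ⟨s, hs, hθ⟩ := exists_eulerDeriv_eq_neg_of_neg_le_re hβ
    (fun z hz => (hdiff z (hsub hz) (hgood z hz).1).differentiableWithinAt) (hdiff z₀ hz₀ hfz₀)
    (eulerLogDeriv_apply_zero f) (fun z hz => (hgood z hz).2.le) hre₀
  exact hadm z₀ hz₀ hfz₀ hre₀ s hs hθ

section PowerSeries

open FormalMultilinearSeries

variable {𝕜 : Type*} [NontriviallyNormedField 𝕜] {f : 𝕜 → 𝕜} {u : ℕ → 𝕜} {r : ENNReal} {z : 𝕜}

lemma hasSum_mul_pow_of_hasFPowerSeriesOnBall (hf : HasFPowerSeriesOnBall f (ofScalars 𝕜 u) 0 r)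
    (hz : z ∈ eball 0 r) : HasSum (fun n => u n * z ^ n) (f z) := by
  simpa [ofScalars_apply_eq, mul_comm] using hf.hasSum hz

lemma derivSeries_ofScalars_apply_diag (u : ℕ → 𝕜) (n : ℕ) (z : 𝕜) :
    derivSeries (ofScalars 𝕜 u) n (fun _ => z) z = ((n + 1 : ℕ) * u (n + 1)) * z ^ (n + 1) := by
  rw [derivSeries_apply_diag, ofScalars_apply_eq, nsmul_eq_mul, smul_eq_mul, mul_assoc]

lemma radius_ofScalars_le_radius_ofScalars_natCast_mul (u : ℕ → 𝕜) :
    (ofScalars 𝕜 u).radius ≤ (ofScalars 𝕜 fun n => n * u n).radius := by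
  refine (radius_le_radius_derivSeries _).trans (ENNReal.le_of_forall_nnreal_lt fun r hr => ?_)
  obtain ⟨C, hC, hbound⟩ := norm_mul_pow_le_of_lt_radius _ hr
  refine le_radius_of_bound _ (C * r) fun n => ?_
  rcases n with _ | n
  · simpa using mul_nonneg hC.le r.coe_nonneg
  have hcoeff : ‖((n + 1 : ℕ) : 𝕜) * u (n + 1)‖ ≤ ‖derivSeries (ofScalars 𝕜 u) n‖ := by
    have hle := ((derivSeries (ofScalars 𝕜 u) n) fun _ => (1 : 𝕜)).le_opNorm 1
    have hle' := (derivSeries (ofScalars 𝕜 u) n).le_opNorm fun _ => (1 : 𝕜)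
    rw [derivSeries_ofScalars_apply_diag] at hle
    simp only [one_pow, mul_one, norm_one, Finset.prod_const_one] at hle hle'
    exact hle.trans hle'
  rw [ofScalars_norm, pow_succ, ← mul_assoc]
  gcongr
  exact (by gcongr : _ ≤ _).trans (hbound n)

lemma hasFPowerSeriesOnBall_eulerDeriv [CompleteSpace 𝕜]
    (hf : HasFPowerSeriesOnBall f (ofScalars 𝕜 u) 0 r) :
    HasFPowerSeriesOnBall (eulerDeriv f) (ofScalars 𝕜 fun n => n * u n) 0 r where
  r_le := hf.r_le.trans (radius_ofScalars_le_radius_ofScalars_natCast_mul u)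
  r_pos := hf.r_pos
  hasSum {z} hz := by
    have hsum := (hf.fderiv.hasSum hz).mapL (ContinuousLinearMap.apply 𝕜 𝕜 z)
    simp only [ContinuousLinearMap.apply_apply, derivSeries_ofScalars_apply_diag, zero_add,
      fderiv_eq_smul_deriv] at hsum
    rw [← hasSum_nat_add_iff' 1]
    simpa [ofScalars_apply_eq, eulerDeriv, mul_comm] using hsum

end PowerSeries

section Hypergeometric

variable {𝕂 : Type*}

lemma ordinaryHypergeometricCoefficient_succ [Field 𝕂] [CharZero 𝕂] {a b c : 𝕂} {n : ℕ}
    (hc : c + n ≠ 0) :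
    (n + 1) * (c + n) * ordinaryHypergeometricCoefficient a b c (n + 1) =
      (a + n) * (b + n) * ordinaryHypergeometricCoefficient a b c n := by
  have hn : (n + 1 : 𝕂) ≠ 0 := by exact_mod_cast n.succ_ne_zero
  simp only [ordinaryHypergeometricCoefficient, ascPochhammer_succ_eval, Nat.factorial_succ,
    Nat.cast_mul, mul_inv, Nat.cast_add, Nat.cast_one]
  field_simp

variable [RCLike 𝕂]

lemma one_le_radius_ordinaryHypergeometricSeries (𝔸 : Type*) [NormedDivisionRing 𝔸]
    [NormedAlgebra 𝕂 𝔸] (a b c : 𝕂) : 1 ≤ (ordinaryHypergeometricSeries 𝔸 a b c).radius := by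
  by_cases h : ∀ k : ℕ, (k : 𝕂) ≠ -a ∧ (k : 𝕂) ≠ -b ∧ (k : 𝕂) ≠ -c
  · exact (ordinaryHypergeometricSeries_radius_eq_one 𝔸 a b c h).ge
  · push Not at h
    obtain ⟨k, hk⟩ := h
    refine le_top.trans_eq (FormalMultilinearSeries.radius_eq_top_of_forall_image_add_eq_zero _
      (1 + k) fun n => ?_).symm
    exact ordinaryHypergeometricSeries_eq_zero_of_neg_nat a b c (by tauto) (by lia)

lemma hasFPowerSeriesOnBall_ordinaryHypergeometric (𝔸 : Type*) [NormedDivisionRing 𝔸]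
    [NormedAlgebra 𝕂 𝔸] [CompleteSpace 𝔸] (a b c : 𝕂) :
    HasFPowerSeriesOnBall (ordinaryHypergeometric a b c) (ordinaryHypergeometricSeries 𝔸 a b c)
      0 1 :=
  have hrad := one_le_radius_ordinaryHypergeometricSeries 𝔸 a b c
  (FormalMultilinearSeries.hasFPowerSeriesOnBall _ (one_pos.trans_le hrad)).mono one_pos hrad

lemma analyticOnNhd_ordinaryHypergeometric (𝔸 : Type*) [NormedDivisionRing 𝔸]
    [NormedAlgebra 𝕂 𝔸] [CompleteSpace 𝔸] (a b c : 𝕂) :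
    AnalyticOnNhd 𝕂 (ordinaryHypergeometric a b c) (ball (0 : 𝔸) 1) := by
  rw [← NNReal.coe_one, ← eball_coe]
  exact (hasFPowerSeriesOnBall_ordinaryHypergeometric 𝔸 a b c).analyticOnNhd

variable {a b c z : 𝕂}

lemma eulerDeriv_eulerDeriv_ordinaryHypergeometric (hc : ∀ n : ℕ, c ≠ -n) (hz : z ∈ ball 0 1) :
    eulerDeriv (eulerDeriv (ordinaryHypergeometric a b c)) z +
        (c - 1) * eulerDeriv (ordinaryHypergeometric a b c) z =
      z * (eulerDeriv (eulerDeriv (ordinaryHypergeometric a b c)) z +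
        (a + b) * eulerDeriv (ordinaryHypergeometric a b c) z +
        a * b * ordinaryHypergeometric a b c z) := by
  rw [← NNReal.coe_one, ← eball_coe] at hz
  have hF := hasFPowerSeriesOnBall_ordinaryHypergeometric 𝕂 a b c
  have hθF := hasFPowerSeriesOnBall_eulerDeriv hF
  have hsum := hasSum_mul_pow_of_hasFPowerSeriesOnBall hF hz
  have hsumθ := hasSum_mul_pow_of_hasFPowerSeriesOnBall hθF hz
  have hsumθθ := hasSum_mul_pow_of_hasFPowerSeriesOnBall (hasFPowerSeriesOnBall_eulerDeriv hθF) hz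
  have hleft := hsumθθ.add (hsumθ.mul_left (c - 1))
  have hright := ((hsumθθ.add (hsumθ.mul_left (a + b))).add (hsum.mul_left (a * b))).mul_left z
  rw [← hasSum_nat_add_iff' 1] at hleft
  simp only [Finset.sum_range_one, Nat.cast_zero, zero_mul, mul_zero, add_zero, sub_zero] at hleft
  refine hleft.unique (hright.congr_fun fun n => ?_)
  push_cast
  linear_combination z ^ (n + 1) * ordinaryHypergeometricCoefficient_succ (a := a) (b := b)
    fun h => hc n (eq_neg_of_add_eq_zero_left h)

lemma eulerDeriv_eulerLogDeriv_ordinaryHypergeometric (hc : ∀ n : ℕ, c ≠ -n) (hz : z ∈ ball 0 1)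
    (hne : ordinaryHypergeometric a b c z ≠ 0) {w : 𝕂 → 𝕂}
    (hw : w = eulerLogDeriv (ordinaryHypergeometric a b c)) :
    eulerDeriv w z + w z ^ 2 + (c - 1) * w z =
      z * (eulerDeriv w z + w z ^ 2 + (a + b) * w z + a * b) := by
  rw [hw, eulerDeriv_eulerLogDeriv (analyticOnNhd_ordinaryHypergeometric 𝕂 a b c z hz) hne]
  simp only [sub_add_cancel, eulerLogDeriv]
  field_simp
  linear_combination eulerDeriv_eulerDeriv_ordinaryHypergeometric (a := a) (b := b) hc hz

end Hypergeometric

section Coefficients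

variable {α p s : ℝ} {a b c w z : ℂ}

/-- The paper's `L`, the coefficient of `(Im w)²` in `norm_sq_sub_norm_sq_eq_quadratic_form`. -/
noncomputable def starlikeCoeffL (α p : ℝ) (a b c : ℂ) : ℝ :=
  (a * b).re / (1 - α) + p * (1 - 2 * α) - ‖a‖ ^ 2 - ‖b‖ ^ 2 + ‖c - 1‖ ^ 2 - 4 * a.im * b.im

/-- The paper's `M`, half the coefficient of `Im w * Re w` in
`norm_sq_sub_norm_sq_eq_quadratic_form`. -/
noncomputable def starlikeCoeffM (α : ℝ) (a b : ℂ) : ℝ :=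
  (a * b * (conj a + conj b - 2 + 2 * (α : ℂ))).im / (1 - α)

/-- The paper's `N`, the coefficient of `(Re w)²` in `norm_sq_sub_norm_sq_eq_quadratic_form`. -/
noncomputable def starlikeCoeffN (α p : ℝ) (a b c : ℂ) : ℝ :=
  (a * b).re / (1 - α) + p * (1 - 2 * α) - ‖a‖ ^ 2 - ‖b‖ ^ 2 + ‖c - 1‖ ^ 2
    - (2 * a.re - ‖a‖ ^ 2 / (1 - α)) * (2 * b.re - ‖b‖ ^ 2 / (1 - α))

lemma quadratic_form_nonneg {𝕜 : Type*} [Field 𝕜] [LinearOrder 𝕜] [IsStrictOrderedRing 𝕜]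
    {L M N : 𝕜} (hL : 0 ≤ L) (hN : 0 ≤ N) (hLMN : 0 ≤ L * N - M ^ 2) (x y : 𝕜) :
    0 ≤ L * x ^ 2 + 2 * M * x * y + N * y ^ 2 := by
  rcases hL.eq_or_lt with rfl | hL
  · obtain rfl : M = 0 := by nlinarith
    simpa using mul_nonneg hN (sq_nonneg y)
  · refine nonneg_of_mul_nonneg_right (a := L) ?_ hL
    have hsquare : L * (L * x ^ 2 + 2 * M * x * y + N * y ^ 2) =
        (L * x + M * y) ^ 2 + (L * N - M ^ 2) * y ^ 2 := by ring
    rw [hsquare]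
    positivity

lemma norm_sq_sub_norm_sq_eq_quadratic_form (hα : α ≠ 1) (hp : (p : ℂ) = a + b + 1 - c)
    (hw : w.re = -(1 - α)) (s : ℝ) :
    ‖-s + w ^ 2 + (c - 1) * w‖ ^ 2 - ‖-s + w ^ 2 + (a + b) * w + a * b‖ ^ 2 =
      starlikeCoeffL α p a b c * w.im ^ 2 + 2 * starlikeCoeffM α a b * w.im * w.re +
        starlikeCoeffN α p a b c * w.re ^ 2 +
        2 * (s - ‖w‖ ^ 2 / (2 * (1 - α))) * ((a * b).re - p * (1 - α)) := by
  have hβ : 1 - α ≠ 0 := sub_ne_zero.2 hα.symm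
  obtain rfl : c = a + b + 1 - p := by rw [hp]; ring
  obtain ⟨a₁, a₂⟩ := a
  obtain ⟨b₁, b₂⟩ := b
  obtain ⟨x, y⟩ := w
  obtain rfl : x = -(1 - α) := hw
  simp only [starlikeCoeffL, starlikeCoeffM, starlikeCoeffN, ← Complex.normSq_eq_norm_sq,
    Complex.normSq_apply]
  simp only [neg_sub, pow_two, Complex.add_re, Complex.neg_re, Complex.ofReal_re, Complex.mul_re,
    Complex.sub_re, Complex.one_re, Complex.sub_im, Complex.add_im, Complex.one_im, add_zero,
    Complex.ofReal_im, sub_zero, Complex.neg_im, neg_zero, Complex.mul_im, zero_add,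
    Complex.conj_im, Complex.im_ofNat, Complex.re_ofNat, mul_zero, zero_mul, Complex.conj_re]
  field_simp
  ring

lemma riccati_ne_of_re_eq (hα : α < 1) (hp : (p : ℂ) = a + b + 1 - c)
    (hre : p * (1 - α) < (a * b).re) (hL : 0 ≤ starlikeCoeffL α p a b c)
    (hN : 0 ≤ starlikeCoeffN α p a b c)
    (hLMN : 0 ≤ starlikeCoeffL α p a b c * starlikeCoeffN α p a b c - starlikeCoeffM α a b ^ 2)
    (hz : ‖z‖ < 1) (hw : w.re = -(1 - α)) (hs : ‖w‖ ^ 2 / (2 * (1 - α)) ≤ s) :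
    -s + w ^ 2 + (c - 1) * w ≠ z * (-s + w ^ 2 + (a + b) * w + a * b) := by
  intro heq
  set A := -s + w ^ 2 + (c - 1) * w with hA
  set B := -s + w ^ 2 + (a + b) * w + a * b with hB
  have hBA : ‖B‖ ≤ ‖A‖ := by
    rw [← sq_le_sq₀ (norm_nonneg _) (norm_nonneg _), ← sub_nonneg,
      norm_sq_sub_norm_sq_eq_quadratic_form hα.ne hp hw]
    exact add_nonneg (quadratic_form_nonneg hL hN hLMN _ _)
      (mul_nonneg (mul_nonneg zero_le_two (sub_nonneg.2 hs)) (sub_nonneg.2 hre.le))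
  have hA0 : A = 0 := by
    by_contra hA0
    have hlt : ‖z‖ * ‖A‖ < ‖A‖ := mul_lt_of_lt_one_left (norm_pos_iff.2 hA0) hz
    refine hlt.not_ge ?_
    calc ‖A‖ = ‖z‖ * ‖B‖ := by rw [heq, norm_mul]
      _ ≤ ‖z‖ * ‖A‖ := by gcongr
  have hB0 : B = 0 := norm_le_zero_iff.1 (hBA.trans (by rw [hA0, norm_zero]))
  have hab : a * b = -(p * w) := by
    rw [hp]
    linear_combination hB0 - hA0
  rw [hab, Complex.neg_re, Complex.re_ofReal_mul, hw] at hre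
  linarith

end Coefficients

lemma starlikeOfOrder_id_mul {F : ℂ → ℂ} {α : ℝ} (hF : AnalyticOnNhd ℂ F (ball 0 1))
    (hF0 : F 0 = 1)
    (hre : ∀ z ∈ ball (0 : ℂ) 1, F z ≠ 0 ∧ -(1 - α) < (eulerLogDeriv F z).re) :
    StarlikeOfOrder α fun z => z * F z := by
  have hderiv := (hasDerivAt_id' (0 : ℂ)).fun_mul (hF 0 (by simp)).differentiableAt.hasDerivAt
  refine ⟨analyticOnNhd_id.mul hF, zero_mul _, ?_,
    fun z hz hz0 => ⟨mul_ne_zero hz0 (hre z hz).1, ?_⟩⟩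
  · simpa [hF0] using hderiv.deriv
  · have hlog : z * deriv (fun w => w * F w) z / (z * F z) = 1 + eulerLogDeriv F z :=
      eulerLogDeriv_id_mul hz0 (hre z hz).1 (hF z hz).differentiableAt
    rw [hlog, Complex.add_re, Complex.one_re]
    linarith [(hre z hz).2]

theorem mainTheorem2_general {α p : ℝ} {a b c : ℂ} (hα : α < 1) (hc : ∀ n : ℕ, c ≠ -n)
    (hp : (p : ℂ) = a + b + 1 - c) (hre : p * (1 - α) < (a * b).re)
    (hL : 0 ≤ starlikeCoeffL α p a b c) (hN : 0 ≤ starlikeCoeffN α p a b c)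
    (hLMN : 0 ≤ starlikeCoeffL α p a b c * starlikeCoeffN α p a b c - starlikeCoeffM α a b ^ 2) :
    StarlikeOfOrder α (shiftedHypergeometric a b c) := by
  have hF := analyticOnNhd_ordinaryHypergeometric ℂ a b c
  have hF0 : ordinaryHypergeometric a b c (0 : ℂ) = 1 := ordinaryHypergeometric_zero a b c
  refine starlikeOfOrder_id_mul hF hF0
    (lt_re_eulerLogDeriv_of_eulerDeriv_ne (sub_pos.2 hα) hF (by simp [hF0]) ?_)
  intro z hz hne hw s hs hθ
  have hriccati := eulerDeriv_eulerLogDeriv_ordinaryHypergeometric hc hz hne rfl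
  rw [hθ] at hriccati
  exact riccati_ne_of_re_eq hα hp hre hL hN hLMN (mem_ball_zero_iff.1 hz) hw hs hriccati

theorem mainTheorem2 (α : ℝ) (hα₀ : 0 ≤ α) (hα₁ : α < 1)
    (a b c : ℂ) (hab : a * b ≠ 0) (hc : ∀ n : ℕ, c ≠ -(n : ℂ))
    (p : ℝ) (hp : (p : ℂ) = a + b + 1 - c)
    (hre : p * (1 - α) < (a * b).re)
    (L M N : ℝ)
    (hL : L = (a * b).re / (1 - α) + p * (1 - 2 * α) - ‖a‖ ^ 2 - ‖b‖ ^ 2 + ‖c - 1‖ ^ 2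
      - 4 * a.im * b.im)
    (hM : M = (a * b * ((starRingEnd ℂ) a + (starRingEnd ℂ) b - 2 + 2 * (α : ℂ))).im / (1 - α))
    (hN : N = (a * b).re / (1 - α) + p * (1 - 2 * α) - ‖a‖ ^ 2 - ‖b‖ ^ 2 + ‖c - 1‖ ^ 2
      - (2 * a.re - ‖a‖ ^ 2 / (1 - α)) * (2 * b.re - ‖b‖ ^ 2 / (1 - α)))
    (hL₀ : 0 ≤ L) (hN₀ : 0 ≤ N) (hLMN : 0 ≤ L * N - M ^ 2) :
    StarlikeOfOrder α (shiftedHypergeometric a b c) := by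
  subst hL hM hN
  exact mainTheorem2_general hα₁ hc hp hre hL₀ hN₀ hLMN
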